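/- Let $(\mathcal{C},\mathbb{E},\mathfrak{s})$ be an extriangulated category in the sense of Nakaoka and Palu ($\mathcal C$ is an additive category), with enough $\mathbb{E}$-projectives and enough $\mathbb{E}$-injectives, and let $n\ge 0$. "Subcategory" means full subcategory, given by a class of objects. An object $P$ is $\mathbb{E}$-projective if $\mathcal C(P,y)$ is surjective for every conflation $A\xrightarrow{x}B\xrightarrow{y}Z$, and $I$ is $\mathbb{E}$-injective if $\mathcal C(x,I)$ is surjective for every such conflation. For a class $\mathcal Y$ let $\Sigma\mathcal{Y}$ be the class of all $Z$ admitting a conflation $Y\to I\to Z$ with $Y\in\mathcal{Y}$ and $I$ an $\mathbb{E}$-injective, and put $\Sigma^0\mathcal{Y}=\mathcal{Y}$, $\Sigma^{k+1}\mathcal{Y}=\Sigma(\Sigma^k\mathcal{Y})$. The higher extension groups are $\mathbb{E}^{k+1}(X,Y)=\mathbb{E}(X,\Sigma^kY)$, $k\ge 0$, computed with any $k$-th cosyzygy of $Y$. For a class $\mathcal{Y}$ and $m\ge 1$ put $$\mathcal{Y}^{\perp_{\le m}}=\{N:\mathbb{E}^j(Y,N)=0\ \ \forall\, Y\in\mathcal{Y},\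 1\le j\le m\},\qquad {}^{\perp_{\le m}}\mathcal{Y}=\{M:\mathbb{E}^j(M,Y)=0\ \ \forall\, Y\in\mathcal{Y},\ 1\le j\le m\}.$$ A subcategory $\mathcal{Y}$ is $(n+2)$-rigid if $\mathbb{E}^j(Y,Y')=0$ for all $Y,Y'\in\mathcal{Y}$ and $1\le j\le n+1$. It is functorially finite if every object $M$ admits a morphism $Y\to M$ with $Y\in\mathcal{Y}$ through which every morphism from an object of $\mathcal{Y}$ to $M$ factors and, dually, a morphism $M\to Y$ with $Y\in\mathcal{Y}$ through which every morphism from $M$ to an object of $\mathcal{Y}$ factors. It is $(n+2)$-cluster tilting if it is functorially finite and $\mathcal{Y}=\mathcal{Y}^{\perp_{\le n+1}}={}^{\perp_{\le n+1}}\mathcal{Y}$. **Theorem.** Let $\mathcal{X}\subseteq\mathcal{C}$ be an $(n+2)$-rigid and functorially finite subcategory such that $\mathcal{X}^{\perp_{\le n+1}}={}^{\perp_{\le n+1}}\mathcal{X}$, and let $\mathcal{R}=\mathcal{R}^{n+1}_{\mathcal{C}}(\mathcal{X}):=\mathcal{X}^{\perp_{\le n+1}}$ be the reduction of $\mathcal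 C$ at $\mathcal X$. Assume that $\mathcal{R}$ is functorially finite in $\mathcal{C}$. Then $\mathcal{R}$, with the restrictions of $\mathbb{E}$ and $\mathfrak{s}$, is an extriangulated category with enough $\mathbb{E}$-projectives and enough $\mathbb{E}$-injectives (so that higher extension groups, orthogonal complements and $(n+2)$-cluster tilting subcategories are defined in $\mathcal{R}$ by means of its own $\mathbb{E}$-injectives and conflations), and the $(n+2)$-cluster tilting subcategories of $\mathcal{R}$ are precisely the $(n+2)$-cluster tilting subcategories $\mathcal{T}$ of $\mathcal{C}$ with $\mathcal{X}\subseteq\mathcal{T}$. -/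

import Mathlib

open CategoryTheory CategoryTheory.Limits Opposite

universe w v u

/-- The data of a bifunctor `𝔼 : 𝒞ᵒᵖ × 𝒞 → Ab` together with a correspondence `𝔰`, given by its graph:
`Realizes x y δ` means that the sequence `A ⟶ B ⟶ Z` given by `x`, `y` represents the class `𝔰(δ)`,
for `δ ∈ 𝔼(Z, A)`. No axiom is imposed here; the axioms are in `ExtensionData.IsExtriangulated`. -/
structure ExtensionData (𝒞 : Type u) [Category.{v} 𝒞] where
  /-- The bifunctor `𝔼`, contravariant in the first variable. -/
  E : 𝒞ᵒᵖ ⥤ 𝒞 ⥤ AddCommGrpCat.{w}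
  /-- The relation "`A ⟶ B ⟶ Z` realizes `δ`". -/
  Realizes : ∀ {A B Z : 𝒞}, (A ⟶ B) → (B ⟶ Z) → (E.obj (op Z)).obj A → Prop

namespace ExtensionData

variable {𝒞 : Type u} [Category.{v} 𝒞]

/-- The group `𝔼(Z, A)` of extensions of `Z` by `A`. -/
abbrev Ext (S : ExtensionData.{w} 𝒞) (Z A : 𝒞) : Type w := (S.E.obj (op Z)).obj A

/-- `a · δ = 𝔼(Z, a)(δ)`. -/
def push (S : ExtensionData.{w} 𝒞) {A A' Z : 𝒞} (a : A ⟶ A') (δ : S.Ext Z A) : S.Ext Z A' :=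
  (S.E.obj (op Z)).map a δ

/-- `δ · c = 𝔼(c, A)(δ)`. -/
def pull (S : ExtensionData.{w} 𝒞) {A Z Z' : 𝒞} (c : Z' ⟶ Z) (δ : S.Ext Z A) : S.Ext Z' A :=
  (S.E.map c.op).app A δ

/-- The axioms of an extriangulated category `(𝒞, 𝔼, 𝔰)`, including that `𝒞` is additive. -/
structure IsExtriangulated [Preadditive 𝒞] (S : ExtensionData.{w} 𝒞) : Prop where
  /-- `𝒞` is additive. -/
  hasFiniteBiproducts : HasFiniteBiproducts 𝒞
  /-- (ET1): `𝔼` is additive in the second variable. -/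
  additive_right : ∀ Z : 𝒞ᵒᵖ, (S.E.obj Z).Additive
  /-- (ET1): `𝔼` is additive in the first variable. -/
  additive_left : ∀ A : 𝒞, (S.E.flip.obj A).Additive
  /-- `𝔰(δ)` is an equivalence class of sequences: it is nonempty. -/
  exists_realizes : ∀ {A Z : 𝒞} (δ : S.Ext Z A),
    ∃ (B : 𝒞) (x : A ⟶ B) (y : B ⟶ Z), S.Realizes x y δ
  /-- `𝔰(δ)` is an equivalence class of sequences: any two of its members are equivalent. -/
  realizes_unique : ∀ {A B B' Z : 𝒞} {x : A ⟶ B} {y : B ⟶ Z} {x' : A ⟶ B'} {y' : B' ⟶ Z}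
    {δ : S.Ext Z A}, S.Realizes x y δ → S.Realizes x' y' δ →
      ∃ b : B ≅ B', x ≫ b.hom = x' ∧ b.hom ≫ y' = y
  /-- `𝔰(δ)` is an equivalence class of sequences: it is closed under equivalence. -/
  realizes_of_iso : ∀ {A B B' Z : 𝒞} {x : A ⟶ B} {y : B ⟶ Z} {x' : A ⟶ B'} {y' : B' ⟶ Z}
    {δ : S.Ext Z A} (b : B ≅ B'), x ≫ b.hom = x' → b.hom ≫ y' = y →
      S.Realizes x y δ → S.Realizes x' y' δ
  /-- (ET2): `𝔰` is a realization. -/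
  realization : ∀ {A B Z A' B' Z' : 𝒞} {x : A ⟶ B} {y : B ⟶ Z} {x' : A' ⟶ B'} {y' : B' ⟶ Z'}
    {δ : S.Ext Z A} {δ' : S.Ext Z' A'}, S.Realizes x y δ → S.Realizes x' y' δ' →
      ∀ (a : A ⟶ A') (c : Z ⟶ Z'), S.push a δ = S.pull c δ' →
        ∃ b : B ⟶ B', x ≫ b = a ≫ x' ∧ y ≫ c = b ≫ y'
  /-- (ET2): `𝔰(0)` is the class of `A ⟶ A ⊕ Z ⟶ Z`. -/
  realizes_zero : ∀ {A Z : 𝒞} (b : BinaryBicone A Z), b.IsBilimit →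
    S.Realizes b.inl b.snd (0 : S.Ext Z A)
  /-- (ET2): `𝔰(δ ⊕ δ') = 𝔰(δ) ⊕ 𝔰(δ')`. -/
  realizes_sum : ∀ {A B Z A' B' Z' : 𝒞} {x : A ⟶ B} {y : B ⟶ Z} {x' : A' ⟶ B'} {y' : B' ⟶ Z'}
    {δ : S.Ext Z A} {δ' : S.Ext Z' A'}, S.Realizes x y δ → S.Realizes x' y' δ' →
      ∀ (a : BinaryBicone A A') (b : BinaryBicone B B') (c : BinaryBicone Z Z'),
        a.IsBilimit → b.IsBilimit → c.IsBilimit →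
          S.Realizes (a.fst ≫ x ≫ b.inl + a.snd ≫ x' ≫ b.inr)
            (b.fst ≫ y ≫ c.inl + b.snd ≫ y' ≫ c.inr)
            (S.push a.inl (S.pull c.fst δ) + S.push a.inr (S.pull c.snd δ'))
  /-- (ET3) -/
  et3 : ∀ {A B Z A' B' Z' : 𝒞} {x : A ⟶ B} {y : B ⟶ Z} {x' : A' ⟶ B'} {y' : B' ⟶ Z'}
    {δ : S.Ext Z A} {δ' : S.Ext Z' A'}, S.Realizes x y δ → S.Realizes x' y' δ' →
      ∀ (a : A ⟶ A') (b : B ⟶ B'), x ≫ b = a ≫ x' →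
        ∃ c : Z ⟶ Z', y ≫ c = b ≫ y' ∧ S.push a δ = S.pull c δ'
  /-- (ET3)ᵒᵖ -/
  et3_op : ∀ {A B Z A' B' Z' : 𝒞} {x : A ⟶ B} {y : B ⟶ Z} {x' : A' ⟶ B'} {y' : B' ⟶ Z'}
    {δ : S.Ext Z A} {δ' : S.Ext Z' A'}, S.Realizes x y δ → S.Realizes x' y' δ' →
      ∀ (b : B ⟶ B') (c : Z ⟶ Z'), y ≫ c = b ≫ y' →
        ∃ a : A ⟶ A', x ≫ b = a ≫ x' ∧ S.push a δ = S.pull c δ'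
  /-- (ET4) -/
  et4 : ∀ {A B D C F : 𝒞} {f : A ⟶ B} {f' : B ⟶ D} {g : B ⟶ C} {g' : C ⟶ F}
    {δ : S.Ext D A} {δ' : S.Ext F B}, S.Realizes f f' δ → S.Realizes g g' δ' →
      ∃ (G : 𝒞) (h' : C ⟶ G) (d : D ⟶ G) (e : G ⟶ F) (δ'' : S.Ext G A),
        g ≫ h' = f' ≫ d ∧ h' ≫ e = g' ∧
        S.Realizes (f ≫ g) h' δ'' ∧ S.Realizes d e (S.push f' δ') ∧
        S.pull d δ'' = δ ∧ S.push f δ'' = S.pull e δ'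
  /-- (ET4)ᵒᵖ -/
  et4_op : ∀ {D A B F C : 𝒞} {f' : D ⟶ A} {f : A ⟶ B} {g' : F ⟶ B} {g : B ⟶ C}
    {δ : S.Ext B D} {δ' : S.Ext C F}, S.Realizes f' f δ → S.Realizes g' g δ' →
      ∃ (G : 𝒞) (d : D ⟶ G) (e : G ⟶ F) (h' : G ⟶ A) (δ'' : S.Ext C G),
        d ≫ h' = f' ∧ h' ≫ f = e ≫ g' ∧
        S.Realizes h' (f ≫ g) δ'' ∧ S.Realizes d e (S.pull g' δ) ∧
        δ' = S.push e δ'' ∧ S.push d δ = S.pull g δ''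

/-- The restriction of `(𝔼, 𝔰)` to the full subcategory on the objects of `𝒟`. -/
def restrict (S : ExtensionData.{w} 𝒞) (𝒟 : ObjectProperty 𝒞) :
    ExtensionData.{w} 𝒟.FullSubcategory where
  E := 𝒟.ι.op ⋙ S.E ⋙ (Functor.whiskeringLeft _ _ _).obj 𝒟.ι
  Realizes x y δ := S.Realizes (𝒟.ι.map x) (𝒟.ι.map y) δ

/-- A conflation is a sequence that realizes some extension. -/
def IsConflation (S : ExtensionData.{w} 𝒞) {A B Z : 𝒞} (x : A ⟶ B) (y : B ⟶ Z) : Prop :=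
  ∃ δ : S.Ext Z A, S.Realizes x y δ

/-- The class of `𝔼`-projective objects. -/
def projectives (S : ExtensionData.{w} 𝒞) : ObjectProperty 𝒞 := fun P =>
  ∀ ⦃A B Z : 𝒞⦄ (x : A ⟶ B) (y : B ⟶ Z), S.IsConflation x y →
    ∀ f : P ⟶ Z, ∃ g : P ⟶ B, g ≫ y = f

/-- The class of `𝔼`-injective objects. -/
def injectives (S : ExtensionData.{w} 𝒞) : ObjectProperty 𝒞 := fun I =>
  ∀ ⦃A B Z : 𝒞⦄ (x : A ⟶ B) (y : B ⟶ Z), S.IsConflation x y →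
    ∀ f : A ⟶ I, ∃ g : B ⟶ I, x ≫ g = f

/-- Every object `Z` admits a conflation `A ⟶ P ⟶ Z` with `P` an `𝔼`-projective. -/
def EnoughProjectives (S : ExtensionData.{w} 𝒞) : Prop :=
  ∀ Z : 𝒞, ∃ (A P : 𝒞) (x : A ⟶ P) (y : P ⟶ Z), S.projectives P ∧ S.IsConflation x y

/-- Every object `A` admits a conflation `A ⟶ I ⟶ Z` with `I` an `𝔼`-injective. -/
def EnoughInjectives (S : ExtensionData.{w} 𝒞) : Prop :=
  ∀ A : 𝒞, ∃ (I Z : 𝒞) (x : A ⟶ I) (y : I ⟶ Z), S.injectives I ∧ S.IsConflation x y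

/-- The cosyzygy class `Σ𝒴`: all `Z` in a conflation `Y ⟶ I ⟶ Z` with `Y ∈ 𝒴` and `I` an
`𝔼`-injective. -/
def cosyzygy (S : ExtensionData.{w} 𝒞) (𝒴 : ObjectProperty 𝒞) : ObjectProperty 𝒞 := fun Z =>
  ∃ (Y I : 𝒞) (x : Y ⟶ I) (y : I ⟶ Z), 𝒴 Y ∧ S.injectives I ∧ S.IsConflation x y

/-- The iterated cosyzygy class `Σᵏ𝒴`, with `Σ⁰𝒴 = 𝒴`. -/
def iterCosyzygy (S : ExtensionData.{w} 𝒞) : ℕ → ObjectProperty 𝒞 → ObjectProperty 𝒞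
  | 0, 𝒴 => 𝒴
  | k + 1, 𝒴 => S.cosyzygy (S.iterCosyzygy k 𝒴)

/-- `𝔼ᵏ⁺¹(X, Y) = 0`, where `𝔼ᵏ⁺¹(X, Y) = 𝔼(X, ΣᵏY)`. In an extriangulated category with enough
`𝔼`-injectives a `k`-th cosyzygy of `Y` exists and `𝔼(X, W)` is, up to isomorphism, the same group
for every `k`-th cosyzygy `W` of `Y`. -/
def HigherExtVanishes (S : ExtensionData.{w} 𝒞) (k : ℕ) (X Y : 𝒞) : Prop :=
  ∀ W : 𝒞, S.iterCosyzygy k (ObjectProperty.singleton Y) W → ∀ δ : S.Ext X W, δ = 0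

/-- `𝒳^{⊥≤m}`: all `N` with `𝔼ʲ(X, N) = 0` for all `X ∈ 𝒳` and `1 ≤ j ≤ m` (here `j = k + 1`). -/
def rightPerp (S : ExtensionData.{w} 𝒞) (m : ℕ) (𝒳 : ObjectProperty 𝒞) : ObjectProperty 𝒞 :=
  fun N => ∀ k < m, ∀ X, 𝒳 X → S.HigherExtVanishes k X N

/-- `^{⊥≤m}𝒳`: all `M` with `𝔼ʲ(M, X) = 0` for all `X ∈ 𝒳` and `1 ≤ j ≤ m` (here `j = k + 1`). -/
def leftPerp (S : ExtensionData.{w} 𝒞) (m : ℕ) (𝒳 : ObjectProperty 𝒞) : ObjectProperty 𝒞 :=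
  fun M => ∀ k < m, ∀ X, 𝒳 X → S.HigherExtVanishes k M X

/-- `𝒳` is `m`-rigid: `𝔼ʲ(𝒳, 𝒳) = 0` for `1 ≤ j ≤ m - 1` (here `j = k + 1`). -/
def IsRigid (S : ExtensionData.{w} 𝒞) (m : ℕ) (𝒳 : ObjectProperty 𝒞) : Prop :=
  ∀ k < m - 1, ∀ X Y, 𝒳 X → 𝒳 Y → S.HigherExtVanishes k X Y

end ExtensionData

/-- `𝒳` is precovering (contravariantly finite) in `𝒞`. -/
def IsPrecovering {𝒞 : Type u} [Category.{v} 𝒞] (𝒳 : ObjectProperty 𝒞) : Prop :=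
  ∀ M : 𝒞, ∃ (X : 𝒞) (f : X ⟶ M), 𝒳 X ∧ ∀ X', 𝒳 X' → ∀ g : X' ⟶ M, ∃ h : X' ⟶ X, h ≫ f = g

/-- `𝒳` is preenveloping (covariantly finite) in `𝒞`. -/
def IsPreenveloping {𝒞 : Type u} [Category.{v} 𝒞] (𝒳 : ObjectProperty 𝒞) : Prop :=
  ∀ M : 𝒞, ∃ (X : 𝒞) (f : M ⟶ X), 𝒳 X ∧ ∀ X', 𝒳 X' → ∀ g : M ⟶ X', ∃ h : X ⟶ X', f ≫ h = g

/-- `𝒳` is functorially finite in `𝒞`. -/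
def IsFunctoriallyFinite {𝒞 : Type u} [Category.{v} 𝒞] (𝒳 : ObjectProperty 𝒞) : Prop :=
  IsPrecovering 𝒳 ∧ IsPreenveloping 𝒳

namespace ExtensionData

variable {𝒞 : Type u} [Category.{v} 𝒞]

/-- `𝒯` is `m`-cluster tilting in `(𝒞, 𝔼, 𝔰)`, for `m ≥ 2`:
`𝒯 = 𝒯^{⊥≤m-1} = ^{⊥≤m-1}𝒯` and `𝒯` is functorially finite in `𝒞`. -/
structure IsClusterTilting (S : ExtensionData.{w} 𝒞) (m : ℕ) (𝒯 : ObjectProperty 𝒞) : Prop where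
  eq_rightPerp : 𝒯 = S.rightPerp (m - 1) 𝒯
  eq_leftPerp : 𝒯 = S.leftPerp (m - 1) 𝒯
  functoriallyFinite : IsFunctoriallyFinite 𝒯

/-- The reduction `ℛᵐ(𝒳) = 𝒳^{⊥≤m}`, considered when `𝒳^{⊥≤m} = ^{⊥≤m}𝒳`. -/
def reduction (S : ExtensionData.{w} 𝒞) (m : ℕ) (𝒳 : ObjectProperty 𝒞) : ObjectProperty 𝒞 :=
  S.rightPerp m 𝒳

end ExtensionData

/-! The reduction `R` is a left perpendicular class, so exactness of `𝔼(Z, W) ⟶ 𝔼(B, W) ⟶ 𝔼(A, W)`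
makes it extension-closed, and the extriangulated structure restricts (`restrict`).

To resolve `M ∈ R`, add a right `𝒳`-approximation `X ⟶ M` to a projective deflation `Q ⟶ M`. The sum
`Q ⊞ X ⟶ M` is again a deflation. Its kernel lies in `R`: the approximation kills the first
extensions, dimension shifting the others. Moreover `Q ⊞ X` has no extensions by `R` in degrees `1,
…, n + 1`, so it is projective in `R`. Cosyzygies are dual.

Dimension shifting along these conflations is therefore valid both in `R` and in `𝒞`, and the two
notions of higher vanishing agree up to degree `n + 1` (`restrict_higherExtVanishes_iff`). The
perpendicular classes then match. Approximations by `𝒯` in `𝒞` arise by composing those by `R` with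
those inside `R`.

Vanishing is required for every cosyzygy, so neither the higher groups nor a full long exact
sequence has to be constructed. -/

namespace ExtensionData

/-! ### Functoriality of extension classes -/

section Functoriality

variable {𝒞 : Type u} [Category.{v} 𝒞] (S : ExtensionData.{w} 𝒞)

lemma push_id {A Z : 𝒞} (δ : S.Ext Z A) : S.push (𝟙 A) δ = δ := by
  simp [push]

lemma push_comp {A A' A'' Z : 𝒞} (a : A ⟶ A') (a' : A' ⟶ A'') (δ : S.Ext Z A) :
    S.push (a ≫ a') δ = S.push a' (S.push a δ) := by
  simp [push]

lemma pull_id {A Z : 𝒞} (δ : S.Ext Z A) : S.pull (𝟙 Z) δ = δ := by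
  simp [pull]

lemma pull_comp {A Z Z' Z'' : 𝒞} (c : Z' ⟶ Z) (c' : Z'' ⟶ Z') (δ : S.Ext Z A) :
    S.pull (c' ≫ c) δ = S.pull c' (S.pull c δ) := by
  simp [pull]

lemma push_pull {A A' Z Z' : 𝒞} (a : A ⟶ A') (c : Z' ⟶ Z) (δ : S.Ext Z A) :
    S.push a (S.pull c δ) = S.pull c (S.push a δ) := by
  have h := (S.E.map c.op).naturality a
  exact (ConcreteCategory.congr_hom h δ).symm

lemma push_zero {A A' Z : 𝒞} (a : A ⟶ A') : S.push a (0 : S.Ext Z A) = 0 :=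
  map_zero _

lemma pull_zero {A Z Z' : 𝒞} (c : Z' ⟶ Z) : S.pull c (0 : S.Ext Z A) = 0 :=
  map_zero _

lemma higherExtVanishes_zero_iff {X Y : 𝒞} :
    S.HigherExtVanishes 0 X Y ↔ ∀ δ : S.Ext X Y, δ = 0 := by
  constructor
  · intro h
    exact h Y (by simp [iterCosyzygy])
  · intro h W hW
    obtain rfl : Y = W := by simpa [iterCosyzygy] using hW
    exact h

end Functoriality

namespace IsExtriangulated

variable {𝒞 : Type u} [Category.{v} 𝒞] [Preadditive 𝒞] {S : ExtensionData.{w} 𝒞}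
  (hS : S.IsExtriangulated)

include hS

lemma hasBinaryBiproducts : HasBinaryBiproducts 𝒞 :=
  have := hS.hasFiniteBiproducts
  hasBinaryBiproducts_of_finite_biproducts 𝒞

lemma realizes_biprod_zero (A Z : 𝒞) [HasBinaryBiproduct A Z] :
    S.Realizes (biprod.inl : A ⟶ A ⊞ Z) biprod.snd (0 : S.Ext Z A) :=
  hS.realizes_zero (BinaryBiproduct.bicone A Z) (BinaryBiproduct.isBilimit A Z)

lemma realizes_id_left (A : 𝒞) {O : 𝒞} (hO : IsZero O) :
    S.Realizes (𝟙 A) (0 : A ⟶ O) (0 : S.Ext O A) := by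
  let b : BinaryBicone A O :=
    { pt := A, fst := 𝟙 A, snd := 0, inl := 𝟙 A, inr := 0, inr_snd := hO.eq_of_src _ _ }
  exact hS.realizes_zero b (isBinaryBilimitOfTotal b (by simp [b]))

lemma realizes_id_right (Z : 𝒞) {O : 𝒞} (hO : IsZero O) :
    S.Realizes (0 : O ⟶ Z) (𝟙 Z) (0 : S.Ext Z O) := by
  let b : BinaryBicone O Z :=
    { pt := Z, fst := 0, snd := 𝟙 Z, inl := 0, inr := 𝟙 Z, inl_fst := hO.eq_of_src _ _ }
  exact hS.realizes_zero b (isBinaryBilimitOfTotal b (by simp [b]))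

lemma exists_isZero : ∃ O : 𝒞, IsZero O := by
  have := hS.hasFiniteBiproducts
  exact ⟨_, isZero_zero 𝒞⟩

/-! ### Exact sequences attached to a conflation -/

section Exactness

variable {A B Z : 𝒞} {x : A ⟶ B} {y : B ⟶ Z} {δ : S.Ext Z A} (h : S.Realizes x y δ)

include h

lemma push_inflation : S.push x δ = 0 := by
  obtain ⟨O, hO⟩ := hS.exists_isZero
  obtain ⟨c, -, hc⟩ := hS.et3 h (hS.realizes_id_left B hO) x (𝟙 B) (by simp)
  rw [hc, S.pull_zero]

lemma pull_deflation : S.pull y δ = 0 := by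
  obtain ⟨O, hO⟩ := hS.exists_isZero
  obtain ⟨a, -, ha⟩ := hS.et3_op (hS.realizes_id_right B hO) h (𝟙 B) y (by simp)
  rw [← ha, S.push_zero]

lemma exists_extension {W : 𝒞} {f : A ⟶ W} (hf : S.push f δ = 0) : ∃ g : B ⟶ W, x ≫ g = f := by
  have := hS.hasBinaryBiproducts
  obtain ⟨b, hb, -⟩ := hS.realization h (hS.realizes_biprod_zero W Z) f (𝟙 Z)
    (by rw [hf, S.pull_zero])
  exact ⟨b ≫ biprod.fst, by rw [← Category.assoc, hb]; simp⟩

lemma exists_lift {W : 𝒞} {f : W ⟶ Z} (hf : S.pull f δ = 0) : ∃ g : W ⟶ B, g ≫ y = f := by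
  have := hS.hasBinaryBiproducts
  obtain ⟨b, -, hb⟩ := hS.realization (hS.realizes_biprod_zero A W) h (𝟙 A) f
    (by rw [hf, S.push_zero])
  exact ⟨biprod.inr ≫ b, by rw [Category.assoc, ← hb]; simp⟩

/-- If `ε` dies on `B`, then `y` lifts to the middle term of `ε`; (ET3)ᵒᵖ turns the lift into a
morphism of conflations over `𝟙 Z`. -/
lemma eq_push_of_pull_eq_zero {W : 𝒞} {ε : S.Ext Z W} (hε : S.pull y ε = 0) :
    ∃ f : A ⟶ W, ε = S.push f δ := by
  obtain ⟨V, i, p, hV⟩ := hS.exists_realizes ε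
  obtain ⟨b, hb⟩ := hS.exists_lift hV hε
  obtain ⟨a, -, ha⟩ := hS.et3_op h hV b (𝟙 Z) (by simp [hb])
  exact ⟨a, by rw [ha, S.pull_id]⟩

lemma eq_pull_of_push_eq_zero {W : 𝒞} {ε : S.Ext W A} (hε : S.push x ε = 0) :
    ∃ f : W ⟶ Z, ε = S.pull f δ := by
  obtain ⟨V, i, p, hV⟩ := hS.exists_realizes ε
  obtain ⟨b, hb⟩ := hS.exists_extension hV hε
  obtain ⟨c, -, hc⟩ := hS.et3 hV h (𝟙 A) b (by simp [hb])
  exact ⟨c, by rw [← hc, S.push_id]⟩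

/-- Exactness of `𝔼(Z, W) ⟶ 𝔼(B, W) ⟶ 𝔼(A, W)`. -/
lemma eq_pull_of_pull_eq_zero {W : 𝒞} {ε : S.Ext B W} (hε : S.pull x ε = 0) :
    ∃ ε' : S.Ext Z W, ε = S.pull y ε' := by
  obtain ⟨V, i, p, hV⟩ := hS.exists_realizes ε
  -- Composing the deflations `V ⟶ B ⟶ Z` gives a kernel `G`, which is an extension of `A` by `W` of
  -- class `S.pull x ε = 0`. A retraction `r` of `d` then carries `δ''` to the required class.
  obtain ⟨G, d, e, h', δ'', -, -, -, hde, hδ, hd⟩ := hS.et4_op hV h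
  obtain ⟨r, hr⟩ := hS.exists_extension hde (f := 𝟙 _) (by rw [hε, S.push_zero])
  refine ⟨S.push r δ'', ?_⟩
  rw [← S.push_pull, ← hd, ← S.push_comp, hr, S.push_id]

end Exactness

/-! ### Projectives, injectives and cosyzygies -/

lemma ext_injective_eq_zero {X I : 𝒞} (hI : S.injectives I) (δ : S.Ext X I) : δ = 0 := by
  obtain ⟨B, x, y, h⟩ := hS.exists_realizes δ
  obtain ⟨g, hg⟩ := hI x y ⟨δ, h⟩ (𝟙 I)
  rw [← S.push_id δ, ← hg, S.push_comp, hS.push_inflation h, S.push_zero]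

lemma ext_projective_eq_zero {P Y : 𝒞} (hP : S.projectives P) (δ : S.Ext P Y) : δ = 0 := by
  obtain ⟨B, x, y, h⟩ := hS.exists_realizes δ
  obtain ⟨g, hg⟩ := hP x y ⟨δ, h⟩ (𝟙 P)
  rw [← S.pull_id δ, ← hg, S.pull_comp, hS.pull_deflation h, S.pull_zero]

lemma projectives_of_ext {P : 𝒞} (hP : ∀ (Y : 𝒞) (δ : S.Ext P Y), δ = 0) : S.projectives P :=
  fun _ _ _ _ _ ⟨_, h⟩ _ => hS.exists_lift h (hP _ _)

lemma injectives_of_ext {I : 𝒞} (hI : ∀ (X : 𝒞) (δ : S.Ext X I), δ = 0) : S.injectives I :=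
  fun _ _ _ _ _ ⟨_, h⟩ _ => hS.exists_extension h (hI _ _)

/-- `𝔼(A, W) = 0` and `𝔼(B, ΣW) = 0` imply `𝔼(Z, ΣW) = 0`. -/
lemma ext_cosyzygy_eq_zero {A B Z W I W' : 𝒞} {x : A ⟶ B} {y : B ⟶ Z} (h : S.IsConflation x y)
    {i : W ⟶ I} {p : I ⟶ W'} (hI : S.injectives I) (hW : S.IsConflation i p)
    (hA : ∀ δ : S.Ext A W, δ = 0) (hB : ∀ δ : S.Ext B W', δ = 0) (ε : S.Ext Z W') : ε = 0 := by
  obtain ⟨δ, h⟩ := h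
  obtain ⟨θ, hW⟩ := hW
  obtain ⟨f, rfl⟩ := hS.eq_push_of_pull_eq_zero h (hB (S.pull y ε))
  obtain ⟨g, rfl⟩ := hS.exists_lift hW (hA (S.pull f θ))
  rw [S.push_comp, hS.ext_injective_eq_zero hI (S.push g δ), S.push_zero]

/-- `𝔼(B, W) = 0` and `𝔼(Z, ΣW) = 0` imply `𝔼(A, W) = 0`. -/
lemma ext_eq_zero_of_cosyzygy {A B Z W I W' : 𝒞} {x : A ⟶ B} {y : B ⟶ Z} (h : S.IsConflation x y)
    {i : W ⟶ I} {p : I ⟶ W'} (hI : S.injectives I) (hW : S.IsConflation i p)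
    (hB : ∀ δ : S.Ext B W, δ = 0) (hZ : ∀ δ : S.Ext Z W', δ = 0) (ε : S.Ext A W) : ε = 0 := by
  obtain ⟨δ, h⟩ := h
  obtain ⟨θ, hW⟩ := hW
  obtain ⟨f, rfl⟩ := hS.eq_pull_of_push_eq_zero hW (hS.ext_injective_eq_zero hI (S.push i ε))
  obtain ⟨g, rfl⟩ := hS.exists_extension h (hZ (S.push f δ))
  rw [S.pull_comp, hB (S.pull g θ), S.pull_zero]

lemma higherExtVanishes_projective {P : 𝒞} (hP : S.projectives P) (k : ℕ) (Y : 𝒞) :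
    S.HigherExtVanishes k P Y := fun _ _ δ => hS.ext_projective_eq_zero hP δ

/-- A conflation starting at an injective splits, so the cosyzygy is a retract of an injective. -/
lemma injectives_iterCosyzygy {I : 𝒞} (hI : S.injectives I) (k : ℕ) (W : 𝒞)
    (hW : S.iterCosyzygy k (ObjectProperty.singleton I) W) : S.injectives W := by
  induction k generalizing W with
  | zero =>
    obtain rfl : I = W := by simpa [iterCosyzygy] using hW
    exact hI
  | succ k ih =>
    obtain ⟨V, J, x, y, hV, hJ, δ, h⟩ := hW
    have hδ := hS.ext_injective_eq_zero (ih V hV) δ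
    obtain ⟨s, hs⟩ := hS.exists_lift h (f := 𝟙 W) (by rw [hδ, S.pull_zero])
    refine hS.injectives_of_ext fun X ε => ?_
    rw [← S.push_id ε, ← hs, S.push_comp, hS.ext_injective_eq_zero hJ (S.push s ε), S.push_zero]

lemma higherExtVanishes_injective {I : 𝒞} (hI : S.injectives I) (k : ℕ) (X : 𝒞) :
    S.HigherExtVanishes k X I := fun W hW δ =>
  hS.ext_injective_eq_zero (hS.injectives_iterCosyzygy hI k W hW) δ

/-! ### Dimension shifting -/

section Shift

variable {A B Z : 𝒞} {x : A ⟶ B} {y : B ⟶ Z} (h : S.IsConflation x y)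

include h

lemma higherExtVanishes_middle {k : ℕ} {Y : 𝒞} (hA : S.HigherExtVanishes k A Y)
    (hZ : S.HigherExtVanishes k Z Y) : S.HigherExtVanishes k B Y := by
  intro W hW ε
  obtain ⟨δ, h⟩ := h
  obtain ⟨ε', rfl⟩ := hS.eq_pull_of_pull_eq_zero h (hA W hW (S.pull x ε))
  rw [hZ W hW ε', S.pull_zero]

lemma higherExtVanishes_succ_right {k : ℕ} {Y : 𝒞} (hA : S.HigherExtVanishes k A Y)
    (hB : S.HigherExtVanishes (k + 1) B Y) : S.HigherExtVanishes (k + 1) Z Y := by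
  rintro W' hW'
  obtain ⟨W, I, i, p, hW, hI, hc⟩ := hW'
  exact hS.ext_cosyzygy_eq_zero h hI hc (hA W hW) (hB W' ⟨W, I, i, p, hW, hI, hc⟩)

lemma higherExtVanishes_left (hinj : S.EnoughInjectives) {k : ℕ} {Y : 𝒞}
    (hB : S.HigherExtVanishes k B Y) (hZ : S.HigherExtVanishes (k + 1) Z Y) :
    S.HigherExtVanishes k A Y := by
  intro W hW
  obtain ⟨I, W', i, p, hI, hc⟩ := hinj W
  exact hS.ext_eq_zero_of_cosyzygy h hI hc (hB W hW) (hZ W' ⟨W, I, i, p, hW, hI, hc⟩)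

lemma higherExtVanishes_succ_iff_of_projective (hinj : S.EnoughInjectives) (hB : S.projectives B)
    (k : ℕ) (Y : 𝒞) : S.HigherExtVanishes (k + 1) Z Y ↔ S.HigherExtVanishes k A Y :=
  ⟨fun hZ => hS.higherExtVanishes_left h hinj (hS.higherExtVanishes_projective hB k Y) hZ,
    fun hA => hS.higherExtVanishes_succ_right h hA (hS.higherExtVanishes_projective hB _ Y)⟩

/-- `𝔼ᵏ⁺¹(X, Z) = 0` and `𝔼ᵏ⁺²(X, B) = 0` imply `𝔼ᵏ⁺²(X, A) = 0`. -/
lemma higherExtVanishes_succ_left (hproj : S.EnoughProjectives) (hinj : S.EnoughInjectives)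
    {k : ℕ} {X : 𝒞} (hZ : S.HigherExtVanishes k X Z) (hB : S.HigherExtVanishes (k + 1) X B) :
    S.HigherExtVanishes (k + 1) X A := by
  induction k generalizing X with
  | zero =>
    -- Replacing `X` by a syzygy `K` lowers the degree by one, so the second variable is left
    -- unshifted.
    obtain ⟨K, P, i, p, hP, hc⟩ := hproj X
    rw [hS.higherExtVanishes_succ_iff_of_projective hc hinj hP,
      higherExtVanishes_zero_iff] at hB ⊢
    rw [higherExtVanishes_zero_iff] at hZ
    intro ε
    obtain ⟨δ, h⟩ := h
    obtain ⟨θ, hc⟩ := hc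
    obtain ⟨f, rfl⟩ := hS.eq_pull_of_push_eq_zero h (hB (S.push x ε))
    obtain ⟨g, rfl⟩ := hS.exists_extension hc (hZ (S.push f θ))
    rw [S.pull_comp, hS.ext_projective_eq_zero hP (S.pull g δ), S.pull_zero]
  | succ k ih =>
    obtain ⟨K, P, i, p, hP, hc⟩ := hproj X
    rw [hS.higherExtVanishes_succ_iff_of_projective hc hinj hP] at hZ hB ⊢
    exact ih hZ hB

end Shift

/-! ### Enlarging inflations and deflations -/

/-- If `i` is an inflation, then so is `(i, f)` for every `f` with the same source. -/
lemma exists_conflation_lift {M E Z X : 𝒞} [HasBinaryBiproduct E X] {i : M ⟶ E} {p : E ⟶ Z}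
    (h : S.IsConflation i p) (f : M ⟶ X) :
    ∃ (G : 𝒞) (q : E ⊞ X ⟶ G), S.IsConflation (biprod.lift i f) q := by
  have := hS.hasBinaryBiproducts
  obtain ⟨O, hO⟩ := hS.exists_isZero
  obtain ⟨δ, h⟩ := h
  -- `(i, f)` is the split inflation `(1, f) : M ⟶ M ⊞ X` followed by `i ⊕ 1`; this sheared bicone
  -- exhibits the splitting, and (ET4) composes the two.
  let b : BinaryBicone M X :=
    { pt := M ⊞ X, fst := biprod.fst, snd := biprod.desc (-f) (𝟙 X)
      inl := biprod.lift (𝟙 M) f, inr := biprod.inr }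
  have hb : b.IsBilimit := isBinaryBilimitOfTotal b (by
    dsimp [b]; ext <;> simp [b])
  have h₁ := hS.realizes_zero b hb
  have h₂ := hS.realizes_sum h (hS.realizes_id_left X hO) _ _ _
    (BinaryBiproduct.isBilimit M X) (BinaryBiproduct.isBilimit E X) (BinaryBiproduct.isBilimit Z O)
  obtain ⟨G, q, -, -, δ', -, -, hG, -⟩ := hS.et4 h₁ h₂
  refine ⟨G, q, δ', ?_⟩
  convert hG using 1
  dsimp [b]
  ext <;> simp

/-- If `p` is a deflation, then so is `(p, f)` for every `f` with the same target. -/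
lemma exists_conflation_desc {M E Z X : 𝒞} [HasBinaryBiproduct E X] {i : Z ⟶ E} {p : E ⟶ M}
    (h : S.IsConflation i p) (f : X ⟶ M) :
    ∃ (G : 𝒞) (q : G ⟶ E ⊞ X), S.IsConflation q (biprod.desc p f) := by
  have := hS.hasBinaryBiproducts
  obtain ⟨O, hO⟩ := hS.exists_isZero
  obtain ⟨δ, h⟩ := h
  let b : BinaryBicone X M :=
    { pt := M ⊞ X, fst := biprod.snd, snd := biprod.desc (𝟙 M) f
      inl := biprod.lift (-f) (𝟙 X), inr := biprod.inl }
  have hb : b.IsBilimit := isBinaryBilimitOfTotal b (by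
    dsimp [b]; ext <;> simp [b])
  have h₁ := hS.realizes_zero b hb
  have h₂ := hS.realizes_sum h (hS.realizes_id_right X hO) _ _ _
    (BinaryBiproduct.isBilimit Z O) (BinaryBiproduct.isBilimit E X) (BinaryBiproduct.isBilimit M X)
  obtain ⟨G, -, -, q, δ', -, -, hG, -⟩ := hS.et4_op h₂ h₁
  refine ⟨G, q, δ', ?_⟩
  convert hG using 1
  dsimp [b]
  ext <;> simp

end IsExtriangulated

end ExtensionData

/-! ### Restriction to extension-closed subcategories -/

namespace ExtensionData

variable {𝒞 : Type u} [Category.{v} 𝒞] [Preadditive 𝒞] {S : ExtensionData.{w} 𝒞}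

namespace IsExtriangulated

variable (hS : S.IsExtriangulated)

include hS

lemma push_add {A A' Z : 𝒞} (a b : A ⟶ A') (δ : S.Ext Z A) :
    S.push (a + b) δ = S.push a δ + S.push b δ := by
  have := hS.additive_right (op Z)
  simp [push, Functor.map_add]

lemma ext_biprod_eq_zero {X A B : 𝒞} [HasBinaryBiproduct A B] (hA : ∀ δ : S.Ext X A, δ = 0)
    (hB : ∀ δ : S.Ext X B, δ = 0) (δ : S.Ext X (A ⊞ B)) : δ = 0 := by
  rw [← S.push_id δ, ← biprod.total, hS.push_add, S.push_comp, S.push_comp,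
    hA (S.push biprod.fst δ), hB (S.push biprod.snd δ), S.push_zero, S.push_zero, add_zero]

lemma hasFiniteBiproducts_fullSubcategory (𝒟 : ObjectProperty 𝒞) (hzero : ∃ O, IsZero O ∧ 𝒟 O)
    (hext : ∀ ⦃A B Z : 𝒞⦄ (x : A ⟶ B) (y : B ⟶ Z), S.IsConflation x y → 𝒟 A → 𝒟 Z → 𝒟 B) :
    HasFiniteBiproducts 𝒟.FullSubcategory := by
  have := hS.hasBinaryBiproducts
  obtain ⟨O, hO, hO'⟩ := hzero
  have : HasZeroObject 𝒟.FullSubcategory := by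
    refine ⟨⟨O, hO'⟩, ?_⟩
    rw [IsZero.iff_id_eq_zero]
    ext
    exact hO.eq_of_src _ _
  have : HasBinaryBiproducts 𝒟.FullSubcategory := by
    refine ⟨fun A B => ?_⟩
    have hAB : 𝒟 (A.obj ⊞ B.obj) :=
      hext _ _ ⟨_, hS.realizes_biprod_zero A.obj B.obj⟩ A.property B.property
    let b : BinaryBicone A B :=
      { pt := ⟨A.obj ⊞ B.obj, hAB⟩
        fst := ObjectProperty.homMk biprod.fst
        snd := ObjectProperty.homMk biprod.snd
        inl := ObjectProperty.homMk biprod.inl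
        inr := ObjectProperty.homMk biprod.inr
        inl_fst := by ext; simp
        inl_snd := by ext; simp
        inr_fst := by ext; simp
        inr_snd := by ext; simp }
    refine hasBinaryBiproduct_of_total b ?_
    apply ObjectProperty.hom_ext
    exact biprod.total
  have : HasFiniteProducts 𝒟.FullSubcategory := hasFiniteProducts_of_has_binary_and_terminal
  exact HasFiniteBiproducts.of_hasFiniteProducts

omit hS in
lemma isBilimit_mapBinaryBicone_ι (𝒟 : ObjectProperty 𝒞) {A B : 𝒟.FullSubcategory}
    {b : BinaryBicone A B} (hb : b.IsBilimit) : Nonempty (𝒟.ι.mapBinaryBicone b).IsBilimit :=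
  ⟨isBinaryBilimitOfTotal _ (𝒟.ι.congr_map (IsBilimit.binary_total hb))⟩

/-- An extension-closed subcategory containing a zero object is extriangulated. -/
lemma restrict (𝒟 : ObjectProperty 𝒞) (hzero : ∃ O, IsZero O ∧ 𝒟 O)
    (hext : ∀ ⦃A B Z : 𝒞⦄ (x : A ⟶ B) (y : B ⟶ Z), S.IsConflation x y → 𝒟 A → 𝒟 Z → 𝒟 B) :
    (S.restrict 𝒟).IsExtriangulated where
  hasFiniteBiproducts := hS.hasFiniteBiproducts_fullSubcategory 𝒟 hzero hext
  additive_right Z := by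
    have := hS.additive_right (op Z.unop.obj)
    exact inferInstanceAs (𝒟.ι ⋙ S.E.obj (op Z.unop.obj)).Additive
  additive_left A := by
    have := hS.additive_left A.obj
    exact inferInstanceAs (𝒟.ι.op ⋙ S.E.flip.obj A.obj).Additive
  exists_realizes {A Z} δ := by
    obtain ⟨B, x, y, h⟩ := hS.exists_realizes (S := S) (A := A.obj) (Z := Z.obj) δ
    exact ⟨⟨B, hext x y ⟨δ, h⟩ A.property Z.property⟩, ObjectProperty.homMk x,
      ObjectProperty.homMk y, h⟩
  realizes_unique h h' := by
    obtain ⟨b, hb, hb'⟩ := hS.realizes_unique h h'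
    exact ⟨𝒟.isoMk b, ObjectProperty.hom_ext _ hb, ObjectProperty.hom_ext _ hb'⟩
  realizes_of_iso b hb hb' h :=
    hS.realizes_of_iso (𝒟.ι.mapIso b) (𝒟.ι.congr_map hb) (𝒟.ι.congr_map hb') h
  realization h h' a c hac := by
    obtain ⟨b, hb, hb'⟩ := hS.realization h h' a.hom c.hom hac
    exact ⟨ObjectProperty.homMk b, ObjectProperty.hom_ext _ hb, ObjectProperty.hom_ext _ hb'⟩
  realizes_zero b hb :=
    hS.realizes_zero _ (isBilimit_mapBinaryBicone_ι 𝒟 hb).some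
  realizes_sum h h' a b c ha hb hc :=
    hS.realizes_sum h h' _ _ _ (isBilimit_mapBinaryBicone_ι 𝒟 ha).some
      (isBilimit_mapBinaryBicone_ι 𝒟 hb).some (isBilimit_mapBinaryBicone_ι 𝒟 hc).some
  et3 h h' a b hab := by
    obtain ⟨c, hc, hc'⟩ := hS.et3 h h' a.hom b.hom (𝒟.ι.congr_map hab)
    exact ⟨ObjectProperty.homMk c, ObjectProperty.hom_ext _ hc, hc'⟩
  et3_op h h' b c hbc := by
    obtain ⟨a, ha, ha'⟩ := hS.et3_op h h' b.hom c.hom (𝒟.ι.congr_map hbc)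
    exact ⟨ObjectProperty.homMk a, ObjectProperty.hom_ext _ ha, ha'⟩
  -- The only new object, `G`, is an extension of `F` by `D`, hence in `𝒟`.
  et4 {A B D C F f f' g g' δ δ'} h h' := by
    obtain ⟨G, k, d, e, δ'', h₁, h₂, h₃, h₄, h₅, h₆⟩ := hS.et4 h h'
    exact ⟨⟨G, hext d e ⟨_, h₄⟩ D.property F.property⟩, ObjectProperty.homMk k,
      ObjectProperty.homMk d, ObjectProperty.homMk e, δ'', ObjectProperty.hom_ext _ h₁,
      ObjectProperty.hom_ext _ h₂, h₃, h₄, h₅, h₆⟩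
  et4_op {D A B F C f' f g' g δ δ'} h h' := by
    obtain ⟨G, d, e, k, δ'', h₁, h₂, h₃, h₄, h₅, h₆⟩ := hS.et4_op h h'
    exact ⟨⟨G, hext d e ⟨_, h₄⟩ D.property F.property⟩, ObjectProperty.homMk d,
      ObjectProperty.homMk e, ObjectProperty.homMk k, δ'', ObjectProperty.hom_ext _ h₁,
      ObjectProperty.hom_ext _ h₂, h₃, h₄, h₅, h₆⟩

lemma leftPerp_of_projective (m : ℕ) (𝒳 : ObjectProperty 𝒞) {P : 𝒞} (hP : S.projectives P) :
    S.leftPerp m 𝒳 P := fun k _ X _ => hS.higherExtVanishes_projective hP k X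

lemma rightPerp_of_injective (m : ℕ) (𝒳 : ObjectProperty 𝒞) {I : 𝒞} (hI : S.injectives I) :
    S.rightPerp m 𝒳 I := fun k _ X _ => hS.higherExtVanishes_injective hI k X

lemma leftPerp_middle (m : ℕ) (𝒳 : ObjectProperty 𝒞) {A B Z : 𝒞} {x : A ⟶ B} {y : B ⟶ Z}
    (h : S.IsConflation x y) (hA : S.leftPerp m 𝒳 A) (hZ : S.leftPerp m 𝒳 Z) :
    S.leftPerp m 𝒳 B :=
  fun k hk X hX => hS.higherExtVanishes_middle h (hA k hk X hX) (hZ k hk X hX)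

lemma restrict_leftPerp (m : ℕ) (𝒳 : ObjectProperty 𝒞) :
    (S.restrict (S.leftPerp m 𝒳)).IsExtriangulated := by
  obtain ⟨O, hO⟩ := hS.exists_isZero
  exact hS.restrict _
    ⟨O, hO, hS.leftPerp_of_projective m 𝒳 fun _ _ _ _ _ _ _ => ⟨0, hO.eq_of_src _ _⟩⟩
    fun _ _ _ _ _ h => hS.leftPerp_middle m 𝒳 h

/-! ### The reduction and its higher extensions -/

section Reduction

variable {n : ℕ} {𝒳 : ObjectProperty 𝒞} (hperp : S.rightPerp (n + 1) 𝒳 = S.leftPerp (n + 1) 𝒳)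
  (hle : 𝒳 ≤ S.rightPerp (n + 1) 𝒳)

include hperp hle

/-- Objects of the reduction admit syzygies in it whose middle term is a sum of an
`𝔼`-projective and an object of `𝒳`. -/
lemma exists_syzygy_rightPerp (hproj : S.EnoughProjectives) (hinj : S.EnoughInjectives)
    (hX : IsPrecovering 𝒳) {M : 𝒞} (hM : S.rightPerp (n + 1) 𝒳 M) :
    ∃ (A P : 𝒞) (x : A ⟶ P) (y : P ⟶ M), S.IsConflation x y ∧
      S.rightPerp (n + 1) 𝒳 A ∧ S.rightPerp (n + 1) 𝒳 P ∧
      ∀ Y, S.rightPerp (n + 1) 𝒳 Y → ∀ k < n + 1, S.HigherExtVanishes k P Y := by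
  have := hS.hasBinaryBiproducts
  obtain ⟨_, Q, _, p, hQ, hp⟩ := hproj M
  obtain ⟨X, f, hX, hf⟩ := hX M
  obtain ⟨A, q, hq⟩ := hS.exists_conflation_desc hp f
  have hQX : S.IsConflation (biprod.inl : Q ⟶ Q ⊞ X) biprod.snd := ⟨_, hS.realizes_biprod_zero Q X⟩
  have hP : S.rightPerp (n + 1) 𝒳 (Q ⊞ X) := by
    have hX' := hle X hX
    rw [hperp] at hX' ⊢
    exact hS.leftPerp_middle _ _ hQX (hS.leftPerp_of_projective _ _ hQ) hX'
  refine ⟨A, Q ⊞ X, q, _, hq, ?_, hP, fun Y hY k hk =>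
    hS.higherExtVanishes_middle hQX (hS.higherExtVanishes_projective hQ k Y) (hY k hk X hX)⟩
  -- In degree one a class dies in `Q ⊞ X`, so it comes from a map `X' ⟶ M`; this factors through
  -- the approximation `f`, hence through the deflation.
  rintro (_ | k) hk X' hX'
  · rw [higherExtVanishes_zero_iff]
    intro ε
    obtain ⟨δ, hq⟩ := hq
    obtain ⟨g, rfl⟩ := hS.eq_pull_of_push_eq_zero hq
      (S.higherExtVanishes_zero_iff.1 (hP 0 hk X' hX') (S.push q ε))
    obtain ⟨t, rfl⟩ := hf X' hX' g
    have ht : t ≫ f = (t ≫ biprod.inr) ≫ biprod.desc p f := by simp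
    rw [ht, S.pull_comp, hS.pull_deflation hq, S.pull_zero]
  · exact hS.higherExtVanishes_succ_left hq hproj hinj (hM k (by omega) X' hX') (hP _ hk X' hX')

/-- Objects of the reduction admit cosyzygies in it whose middle term is a sum of an
`𝔼`-injective and an object of `𝒳`. -/
lemma exists_cosyzygy_rightPerp (hinj : S.EnoughInjectives)
    (hX : IsPreenveloping 𝒳) {M : 𝒞} (hM : S.rightPerp (n + 1) 𝒳 M) :
    ∃ (J Z : 𝒞) (x : M ⟶ J) (y : J ⟶ Z), S.IsConflation x y ∧
      S.rightPerp (n + 1) 𝒳 J ∧ S.rightPerp (n + 1) 𝒳 Z ∧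
      ∀ Y, S.rightPerp (n + 1) 𝒳 Y → ∀ δ : S.Ext Y J, δ = 0 := by
  have := hS.hasBinaryBiproducts
  obtain ⟨I, _, i, _, hI, hi⟩ := hinj M
  obtain ⟨X, f, hX, hf⟩ := hX M
  obtain ⟨Z, q, hq⟩ := hS.exists_conflation_lift hi f
  have hJ : S.leftPerp (n + 1) 𝒳 (I ⊞ X) := by
    refine hS.leftPerp_middle _ _ ⟨_, hS.realizes_biprod_zero I X⟩ ?_ ?_
    · exact hperp ▸ hS.rightPerp_of_injective _ _ hI
    · exact hperp ▸ hle X hX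
  rw [hperp] at hM ⊢
  refine ⟨I ⊞ X, Z, _, q, hq, hJ, ?_, fun Y hY => hS.ext_biprod_eq_zero
    (hS.ext_injective_eq_zero hI) (S.higherExtVanishes_zero_iff.1 (hY 0 (by omega) X hX))⟩
  -- Dually, a class in `𝔼(Z, X')` comes from a map `M ⟶ X'`, which extends along the inflation.
  -- Testing on the left lets `higherExtVanishes_succ_right` handle the higher degrees.
  rintro (_ | k) hk X' hX'
  · rw [higherExtVanishes_zero_iff]
    intro ε
    obtain ⟨δ, hq⟩ := hq
    obtain ⟨g, rfl⟩ := hS.eq_push_of_pull_eq_zero hq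
      (S.higherExtVanishes_zero_iff.1 (hJ 0 hk X' hX') (S.pull q ε))
    obtain ⟨t, rfl⟩ := hf X' hX' g
    have ht : f ≫ t = biprod.lift i f ≫ (biprod.snd ≫ t) := by simp
    rw [ht, S.push_comp, hS.push_inflation hq, S.push_zero]
  · exact hS.higherExtVanishes_succ_right hq (hM k (by omega) X' hX') (hJ _ hk X' hX')

lemma restrict_rightPerp_enoughProjectives (hproj : S.EnoughProjectives)
    (hinj : S.EnoughInjectives) (hX : IsPrecovering 𝒳) :
    (S.restrict (S.rightPerp (n + 1) 𝒳)).EnoughProjectives := by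
  intro M
  have hR : (S.restrict (S.rightPerp (n + 1) 𝒳)).IsExtriangulated :=
    hperp ▸ hS.restrict_leftPerp _ _
  obtain ⟨A, P, x, y, ⟨δ, h⟩, hA, hP, hP'⟩ :=
    hS.exists_syzygy_rightPerp hperp hle hproj hinj hX M.property
  refine ⟨⟨A, hA⟩, ⟨P, hP⟩, ObjectProperty.homMk x, ObjectProperty.homMk y, ?_, δ, h⟩
  exact hR.projectives_of_ext fun Y =>
    S.higherExtVanishes_zero_iff.1 (hP' Y.obj Y.property 0 (by omega))

lemma restrict_rightPerp_enoughInjectives (hinj : S.EnoughInjectives)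
    (hX : IsPreenveloping 𝒳) : (S.restrict (S.rightPerp (n + 1) 𝒳)).EnoughInjectives := by
  intro M
  have hR : (S.restrict (S.rightPerp (n + 1) 𝒳)).IsExtriangulated :=
    hperp ▸ hS.restrict_leftPerp _ _
  obtain ⟨J, Z, x, y, ⟨δ, h⟩, hJ, hZ, hJ'⟩ :=
    hS.exists_cosyzygy_rightPerp hperp hle hinj hX M.property
  refine ⟨⟨J, hJ⟩, ⟨Z, hZ⟩, ObjectProperty.homMk x, ObjectProperty.homMk y, ?_, δ, h⟩
  exact hR.injectives_of_ext fun Y => hJ' Y.obj Y.property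

/-- In degrees at most `n + 1`, vanishing of extensions in the reduction agrees with vanishing in
the ambient category. -/
lemma restrict_higherExtVanishes_iff (hproj : S.EnoughProjectives)
    (hinj : S.EnoughInjectives) (hX : IsFunctoriallyFinite 𝒳) {k : ℕ} (hk : k < n + 1)
    (M N : (S.rightPerp (n + 1) 𝒳).FullSubcategory) :
    (S.restrict (S.rightPerp (n + 1) 𝒳)).HigherExtVanishes k M N ↔
      S.HigherExtVanishes k M.obj N.obj := by
  have hR : (S.restrict (S.rightPerp (n + 1) 𝒳)).IsExtriangulated :=
    hperp ▸ hS.restrict_leftPerp _ _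
  induction k generalizing M with
  | zero =>
    rw [higherExtVanishes_zero_iff, higherExtVanishes_zero_iff]
    exact Iff.rfl
  | succ k ih =>
    obtain ⟨A, P, x, y, h, hA, hP, hP'⟩ :=
      hS.exists_syzygy_rightPerp hperp hle hproj hinj hX.1 M.property
    obtain ⟨δ, hδ⟩ := id h
    have hc : (S.restrict (S.rightPerp (n + 1) 𝒳)).IsConflation (A := ⟨A, hA⟩) (B := ⟨P, hP⟩)
      (Z := M) (ObjectProperty.homMk x) (ObjectProperty.homMk y) := ⟨δ, hδ⟩
    refine (hR.higherExtVanishes_succ_iff_of_projective hc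
      (hS.restrict_rightPerp_enoughInjectives hperp hle hinj hX.2)
      (hR.projectives_of_ext fun Y => S.higherExtVanishes_zero_iff.1
        (hP' Y.obj Y.property 0 (Nat.succ_pos n))) k N).trans
        ((ih (Nat.lt_of_succ_lt hk) ⟨A, hA⟩).trans ?_)
    -- `P` need not be projective in `𝒞`; the ambient shift uses its vanishing against `R` in every
    -- degree up to `n + 1`.
    exact ⟨fun hA => hS.higherExtVanishes_succ_right h hA (hP' _ N.property _ hk),
      fun hM => hS.higherExtVanishes_left h hinj (hP' _ N.property _ (by omega)) hM⟩

end Reduction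

end IsExtriangulated

end ExtensionData

/-! ### Comparison of cluster tilting subcategories -/

theorem mainTheorem1 {𝒞 : Type u} [Category.{v} 𝒞] [Preadditive 𝒞]
    (S : ExtensionData.{w} 𝒞) (hS : S.IsExtriangulated)
    (hproj : S.EnoughProjectives) (hinj : S.EnoughInjectives)
    (n : ℕ) (𝒳 : ObjectProperty 𝒞)
    (hrigid : S.IsRigid (n + 2) 𝒳) (hff : IsFunctoriallyFinite 𝒳)
    (hperp : S.rightPerp (n + 1) 𝒳 = S.leftPerp (n + 1) 𝒳)
    (hred : IsFunctoriallyFinite (S.reduction (n + 1) 𝒳)) :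
    ((S.restrict (S.reduction (n + 1) 𝒳)).IsExtriangulated ∧
      (S.restrict (S.reduction (n + 1) 𝒳)).EnoughProjectives ∧
      (S.restrict (S.reduction (n + 1) 𝒳)).EnoughInjectives) ∧
    ∀ 𝒯 : ObjectProperty 𝒞,
      (𝒯 ≤ S.reduction (n + 1) 𝒳 ∧
        (S.restrict (S.reduction (n + 1) 𝒳)).IsClusterTilting (n + 2)
          (𝒯.inverseImage (S.reduction (n + 1) 𝒳).ι)) ↔
      (S.IsClusterTilting (n + 2) 𝒯 ∧ 𝒳 ≤ 𝒯) := by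
  have hle : 𝒳 ≤ S.rightPerp (n + 1) 𝒳 := fun Y hY k hk X hX => hrigid k hk X Y hX hY
  have hiff := @fun k hk => hS.restrict_higherExtVanishes_iff hperp hle hproj hinj hff (k := k) hk
  have hrestr : (S.restrict (S.rightPerp (n + 1) 𝒳)).IsExtriangulated :=
    hperp ▸ hS.restrict_leftPerp _ _
  unfold ExtensionData.reduction at *
  set R := S.rightPerp (n + 1) 𝒳 with hR
  have hright : ∀ 𝒯 ≤ R, ∀ N : R.FullSubcategory,
      (S.restrict R).rightPerp (n + 1) (𝒯.inverseImage R.ι) N ↔ S.rightPerp (n + 1) 𝒯 N.obj :=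
    fun 𝒯 h𝒯 N =>
      ⟨fun h k hk X hX => (hiff k hk ⟨X, h𝒯 X hX⟩ N).1 (h k hk ⟨X, h𝒯 X hX⟩ hX),
        fun h k hk X hX => (hiff k hk X N).2 (h k hk X.obj hX)⟩
  have hleft : ∀ 𝒯 ≤ R, ∀ N : R.FullSubcategory,
      (S.restrict R).leftPerp (n + 1) (𝒯.inverseImage R.ι) N ↔ S.leftPerp (n + 1) 𝒯 N.obj :=
    fun 𝒯 h𝒯 N =>
      ⟨fun h k hk X hX => (hiff k hk N ⟨X, h𝒯 X hX⟩).1 (h k hk ⟨X, h𝒯 X hX⟩ hX),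
        fun h k hk X hX => (hiff k hk N X).2 (h k hk X.obj hX)⟩
  refine ⟨⟨hrestr, hS.restrict_rightPerp_enoughProjectives hperp hle hproj hinj hff.1,
    hS.restrict_rightPerp_enoughInjectives hperp hle hinj hff.2⟩, fun 𝒯 => ⟨?_, ?_⟩⟩
  · rintro ⟨h𝒯, hT⟩
    have hr : ∀ N : R.FullSubcategory, 𝒯 N.obj ↔ S.rightPerp (n + 1) 𝒯 N.obj := fun N =>
      (iff_of_eq (congrFun hT.eq_rightPerp N)).trans (hright 𝒯 h𝒯 N)
    have hl : ∀ N : R.FullSubcategory, 𝒯 N.obj ↔ S.leftPerp (n + 1) 𝒯 N.obj := fun N =>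
      (iff_of_eq (congrFun hT.eq_leftPerp N)).trans (hleft 𝒯 h𝒯 N)
    -- Since `𝒯 ≤ R`, the objects of `𝒳` have no extensions by `𝒯`, so left maximality of `𝒯` in `R`
    -- absorbs them.
    have h𝒳 : 𝒳 ≤ 𝒯 := fun X hX => (hl ⟨X, hle X hX⟩).2 fun k hk Y hY => h𝒯 Y hY k hk X hX
    refine ⟨⟨?_, ?_, ?_, ?_⟩, h𝒳⟩
    · ext N
      refine ⟨fun hN => (hr ⟨N, h𝒯 N hN⟩).1 hN, fun hN => ?_⟩
      -- Maximality is only known inside `R`; `𝒳 ≤ 𝒯` first places `N` there.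
      exact (hr ⟨N, fun k hk X hX => hN k hk X (h𝒳 X hX)⟩).2 hN
    · ext N
      refine ⟨fun hN => (hl ⟨N, h𝒯 N hN⟩).1 hN, fun hN => ?_⟩
      exact (hl ⟨N, hperp ▸ fun k hk X hX => hN k hk X (h𝒳 X hX)⟩).2 hN
    · intro M
      obtain ⟨L, f, hL, hf⟩ := hred.1 M
      obtain ⟨T, g, hT', hg⟩ := hT.functoriallyFinite.1 ⟨L, hL⟩
      refine ⟨T.obj, g.hom ≫ f, hT', fun T₁ hT₁ t => ?_⟩
      obtain ⟨s, rfl⟩ := hf T₁ (h𝒯 T₁ hT₁) t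
      obtain ⟨r, hr⟩ := hg ⟨T₁, h𝒯 T₁ hT₁⟩ hT₁ (ObjectProperty.homMk s)
      exact ⟨r.hom, by rw [← Category.assoc]; exact congrArg (· ≫ f) (R.ι.congr_map hr)⟩
    · intro M
      obtain ⟨L, f, hL, hf⟩ := hred.2 M
      obtain ⟨T, g, hT', hg⟩ := hT.functoriallyFinite.2 ⟨L, hL⟩
      refine ⟨T.obj, f ≫ g.hom, hT', fun T₁ hT₁ t => ?_⟩
      obtain ⟨s, rfl⟩ := hf T₁ (h𝒯 T₁ hT₁) t
      obtain ⟨r, hr⟩ := hg ⟨T₁, h𝒯 T₁ hT₁⟩ hT₁ (ObjectProperty.homMk s)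
      exact ⟨r.hom, by rw [Category.assoc]; exact congrArg (f ≫ ·) (R.ι.congr_map hr)⟩
  · rintro ⟨hT, h𝒳⟩
    have h𝒯 : 𝒯 ≤ R := fun N hN k hk X hX =>
      (iff_of_eq (congrFun hT.eq_rightPerp N)).1 hN k hk X (h𝒳 X hX)
    refine ⟨h𝒯, ⟨?_, ?_, ?_, ?_⟩⟩
    · ext N
      exact (iff_of_eq (congrFun hT.eq_rightPerp N.obj)).trans (hright 𝒯 h𝒯 N).symm
    · ext N
      exact (iff_of_eq (congrFun hT.eq_leftPerp N.obj)).trans (hleft 𝒯 h𝒯 N).symm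
    · intro M
      obtain ⟨T, g, hT', hg⟩ := hT.functoriallyFinite.1 M.obj
      refine ⟨⟨T, h𝒯 T hT'⟩, ObjectProperty.homMk g, hT', fun T₁ hT₁ t => ?_⟩
      obtain ⟨r, hr⟩ := hg T₁.obj hT₁ t.hom
      exact ⟨ObjectProperty.homMk r, ObjectProperty.hom_ext _ hr⟩
    · intro M
      obtain ⟨T, g, hT', hg⟩ := hT.functoriallyFinite.2 M.obj
      refine ⟨⟨T, h𝒯 T hT'⟩, ObjectProperty.homMk g, hT', fun T₁ hT₁ t => ?_⟩
      obtain ⟨r, hr⟩ := hg T₁.obj hT₁ t.hom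
      exact ⟨ObjectProperty.homMk r, ObjectProperty.hom_ext _ hr⟩
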